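/- Let $m,n\in\mathbb N$ and let $M_k(\mathbb C)$ denote the complex $k\times k$ matrices. A linear map $\Phi:M_m(\mathbb C)\to M_n(\mathbb C)$ is called a Schwarz map if $\Phi(K^*K)\ge \Phi(K)^*\Phi(K)$ (in the sense that the difference is positive semidefinite) for all $K\in M_m(\mathbb C)$, and unital if $\Phi(\mathbf 1)=\mathbf 1$. Let $\Phi^\dagger:M_n(\mathbb C)\to M_m(\mathbb C)$ denote the adjoint of $\Phi$ with respect to the Hilbert--Schmidt inner products $\langle X,Y\rangle=\operatorname{tr}[X^*Y]$. Let $0<p\le 1$ and let $\Phi:M_m(\mathbb C)\to M_n(\mathbb C)$ be a unital Schwarz map. Then for every positive definite $A\in M_n(\mathbb C)$ and every $B\in M_m(\mathbb C)$, $$\operatorname{tr}\big[(\Phi(B)^*A^p\,\Phi(B))^{1/p}\big]\;\le\;\operatorname{tr}\big[(B^*\,\Phi^\dagger(A)^p\,B)^{1/p}\big],$$ where real powers of positive semidefinite matrices are defined by the functional calculus. -/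

import Mathlib

open scoped Matrix MatrixOrder ComplexOrder

/-- A Schwarz map `Φ : M_m(ℂ) → M_n(ℂ)`: a linear map with `Φ(K^* K) ≥ Φ(K)^* Φ(K)` for all `K`,
where `≥` is the Loewner order. -/
def IsSchwarzMap {m n : ℕ}
    (Φ : Matrix (Fin m) (Fin m) ℂ →ₗ[ℂ] Matrix (Fin n) (Fin n) ℂ) : Prop :=
  ∀ K : Matrix (Fin m) (Fin m) ℂ, (Φ K)ᴴ * Φ K ≤ Φ (Kᴴ * K)

/-- A map is unital if it sends the identity matrix to the identity matrix. -/
def IsUnitalMap {m n : ℕ}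
    (Φ : Matrix (Fin m) (Fin m) ℂ →ₗ[ℂ] Matrix (Fin n) (Fin n) ℂ) : Prop :=
  Φ 1 = 1

/-- The adjoint `Φ^†` of `Φ` for the Hilbert–Schmidt inner products `⟨X, Y⟩ = tr (X^* Y)`.
Its `(i, j)` entry at `Y` is `⟨E_ij, Φ^†(Y)⟩ = ⟨Φ(E_ij), Y⟩`, with `E_ij` the matrix units;
`eq_hsAdjoint_iff` shows that it is the unique map with the defining property of the adjoint. -/
noncomputable def hsAdjoint {m n : ℕ}
    (Φ : Matrix (Fin m) (Fin m) ℂ →ₗ[ℂ] Matrix (Fin n) (Fin n) ℂ) :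
    Matrix (Fin n) (Fin n) ℂ →ₗ[ℂ] Matrix (Fin m) (Fin m) ℂ where
  toFun Y := Matrix.of fun i j => ((Φ (Matrix.single i j 1))ᴴ * Y).trace
  map_add' Y Z := by
    ext i j
    simp [Matrix.mul_add]
  map_smul' c Y := by
    ext i j
    simp

theorem trace_conjTranspose_mul_hsAdjoint {m n : ℕ}
    (Φ : Matrix (Fin m) (Fin m) ℂ →ₗ[ℂ] Matrix (Fin n) (Fin n) ℂ)
    (X : Matrix (Fin m) (Fin m) ℂ) (Y : Matrix (Fin n) (Fin n) ℂ) :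
    (Xᴴ * hsAdjoint Φ Y).trace = ((Φ X)ᴴ * Y).trace := by
  have hX : Φ X = ∑ i, ∑ j, X i j • Φ (Matrix.single i j 1) := by
    conv_lhs => rw [Matrix.matrix_eq_sum_single X]
    simp only [map_sum]
    refine Finset.sum_congr rfl fun i _ => Finset.sum_congr rfl fun j _ => ?_
    rw [← map_smul, Matrix.smul_single, smul_eq_mul, mul_one]
  rw [hX]
  simp only [Matrix.conjTranspose_sum, Matrix.conjTranspose_smul, Matrix.sum_mul,
    Matrix.smul_mul, Matrix.trace_sum, Matrix.trace_smul, smul_eq_mul]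
  rw [Finset.sum_comm]
  simp [Matrix.trace, Matrix.mul_apply, hsAdjoint]

theorem eq_hsAdjoint_iff {m n : ℕ}
    (Φ : Matrix (Fin m) (Fin m) ℂ →ₗ[ℂ] Matrix (Fin n) (Fin n) ℂ)
    (Ψ : Matrix (Fin n) (Fin n) ℂ → Matrix (Fin m) (Fin m) ℂ) :
    Ψ = hsAdjoint Φ ↔ ∀ X Y, (Xᴴ * Ψ Y).trace = ((Φ X)ᴴ * Y).trace := by
  constructor
  · rintro rfl X Y
    exact trace_conjTranspose_mul_hsAdjoint Φ X Y
  · intro h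
    funext Y
    have h0 : ((Ψ Y - hsAdjoint Φ Y)ᴴ * (Ψ Y - hsAdjoint Φ Y)).trace = 0 := by
      rw [Matrix.mul_sub, Matrix.trace_sub, h, trace_conjTranspose_mul_hsAdjoint, sub_self]
    exact sub_eq_zero.mp (Matrix.trace_conjTranspose_mul_self_eq_zero_iff.mp h0)

/-! ### Scalar weighted geometric means as mixtures of parallel sums -/

section Interpolation

open MeasureTheory Set

variable {ι : Type*} [Fintype ι] {p : ℝ}

/-! For p < 1, put X = Φ(B)^* A^p Φ(B), X' = B^* Φ†(A)^p B and Z = X^(1/p). Lieb monotonicity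
(`IsSchwarzMap.re_trace_rpow_mul_rpow_le`) gives tr X^(1/p) = tr X Z^(1-p) ≤ tr X' Φ†(Z)^(1-p).
Young's trace inequality bounds the right side by p tr X'^(1/p) + (1-p) tr Φ†(Z), and tr Φ†(Z) = tr
Z because Φ is unital; cancel.

Monotonicity is interpolation: a^p z^(1-p) is a positive mixture over t > 0 of the parallel sums of
a and tz, so these suffice. The parallel sum of left multiplication by A and right multiplication by
tZ, evaluated at C, is the minimum of tr U^*AU + t tr W^*WZ over C = U + W. Φ carries decompositions
of B to decompositions of Φ(B), and the Schwarz inequality controls each term. -/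

theorem integrableOn_sum_rpowIntegrand₀₁ (hp : p ∈ Ioo (0 : ℝ) 1) {a z : ι → ℝ} (w : ι → ℝ)
    (ha : ∀ i, 0 ≤ a i) (hz : ∀ i, 0 ≤ z i) :
    IntegrableOn (fun t => ∑ i, Real.rpowIntegrand₀₁ p t (a i / z i) * (z i * w i)) (Ioi 0) :=
  integrable_finsetSum _ fun i _ =>
    (Real.integrableOn_rpowIntegrand₀₁_Ioi hp (div_nonneg (ha i) (hz i))).mul_const _

theorem integral_sum_rpowIntegrand₀₁ (hp : p ∈ Ioo (0 : ℝ) 1) {a z : ι → ℝ} (w : ι → ℝ)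
    (ha : ∀ i, 0 ≤ a i) (hz : ∀ i, 0 ≤ z i) :
    ∫ t in Ioi 0, ∑ i, Real.rpowIntegrand₀₁ p t (a i / z i) * (z i * w i) =
      (∑ i, a i ^ p * z i ^ (1 - p) * w i) * ∫ t in Ioi 0, Real.rpowIntegrand₀₁ p t 1 := by
  rw [integral_finsetSum _ fun i _ =>
    (Real.integrableOn_rpowIntegrand₀₁_Ioi hp (div_nonneg (ha i) (hz i))).mul_const _,
    Finset.sum_mul]
  refine Finset.sum_congr rfl fun i _ => ?_
  rw [integral_mul_const,
    Real.integral_rpowIntegrand₀₁_eq_rpow_mul_const hp (div_nonneg (ha i) (hz i))]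
  -- For z = 0 the quotient a / z is a junk value, but both sides vanish, since 1 - p ≠ 0.
  rcases (hz i).eq_or_lt with hi | hi
  · simp [← hi, Real.zero_rpow (sub_pos.2 hp.2).ne']
  · rw [Real.div_rpow (ha i) (hz i), Real.rpow_sub hi, Real.rpow_one]
    field_simp

theorem sum_rpowIntegrand₀₁_eq_parallelSum (hp : p ∈ Ioo (0 : ℝ) 1) {a z : ι → ℝ} (w : ι → ℝ)
    (ha : ∀ i, 0 ≤ a i) (hz : ∀ i, 0 ≤ z i) {t : ℝ} (ht : 0 < t) :
    ∑ i, Real.rpowIntegrand₀₁ p t (a i / z i) * (z i * w i) =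
      t ^ (p - 1) / t * ∑ i, a i * (t * z i) / (a i + t * z i) * w i := by
  rw [Finset.mul_sum]
  refine Finset.sum_congr rfl fun i _ => ?_
  rw [Real.rpowIntegrand₀₁_eq_pow_div hp ht.le (div_nonneg (ha i) (hz i))]
  rcases (hz i).eq_or_lt with hi | hi
  · simp [← hi]
  · have h1 : 0 < a i + t * z i := add_pos_of_nonneg_of_pos (ha i) (mul_pos ht hi)
    have h2 : t + a i / z i = (a i + t * z i) / z i := by field_simp; ring
    rw [h2]
    field_simp

/-- If the parallel sums `a (t z) / (a + t z)`, summed against weights, are dominated for every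
`t > 0`, then so are the weighted geometric means `a ^ p * z ^ (1 - p)`. -/
theorem sum_rpow_mul_rpow_le_of_parallelSum_le {κ : Type*} [Fintype κ]
    (hp : p ∈ Ioo (0 : ℝ) 1) {a z w : ι → ℝ} {a' z' w' : κ → ℝ}
    (ha : ∀ i, 0 ≤ a i) (hz : ∀ i, 0 ≤ z i) (ha' : ∀ i, 0 ≤ a' i) (hz' : ∀ i, 0 ≤ z' i)
    (h : ∀ t : ℝ, 0 < t → ∑ i, a i * (t * z i) / (a i + t * z i) * w i ≤
      ∑ i, a' i * (t * z' i) / (a' i + t * z' i) * w' i) :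
    ∑ i, a i ^ p * z i ^ (1 - p) * w i ≤ ∑ i, a' i ^ p * z' i ^ (1 - p) * w' i := by
  refine le_of_mul_le_mul_right ?_ (Real.integral_rpowIntegrand₀₁_one_pos hp)
  rw [← integral_sum_rpowIntegrand₀₁ hp w ha hz, ← integral_sum_rpowIntegrand₀₁ hp w' ha' hz']
  refine setIntegral_mono_on (integrableOn_sum_rpowIntegrand₀₁ hp w ha hz)
    (integrableOn_sum_rpowIntegrand₀₁ hp w' ha' hz') measurableSet_Ioi fun t ht => ?_
  rw [sum_rpowIntegrand₀₁_eq_parallelSum hp w ha hz ht,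
    sum_rpowIntegrand₀₁_eq_parallelSum hp w' ha' hz' ht]
  exact mul_le_mul_of_nonneg_left (h t ht)
    (div_nonneg (Real.rpow_nonneg (le_of_lt ht) _) (le_of_lt ht))

end Interpolation

/-- The parallel sum as a lower bound for quadratic decompositions. -/
theorem parallelSum_mul_norm_add_sq_le {a b : ℝ} (ha : 0 ≤ a) (hb : 0 ≤ b) (u v : ℂ) :
    a * b / (a + b) * ‖u + v‖ ^ 2 ≤ a * ‖u‖ ^ 2 + b * ‖v‖ ^ 2 := by
  rcases (add_nonneg ha hb).eq_or_lt with h | h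
  · rw [← h]
    simp only [div_zero, zero_mul]
    positivity
  · have h1 : ‖u + v‖ ^ 2 ≤ (‖u‖ + ‖v‖) ^ 2 := by gcongr; exact norm_add_le u v
    calc a * b / (a + b) * ‖u + v‖ ^ 2 ≤ a * b / (a + b) * (‖u‖ + ‖v‖) ^ 2 := by gcongr
      _ ≤ a * ‖u‖ ^ 2 + b * ‖v‖ ^ 2 := by
        rw [div_mul_eq_mul_div, div_le_iff₀ h]
        nlinarith [sq_nonneg (a * ‖u‖ - b * ‖v‖)]

/-- The parallel sum is attained by the optimal decomposition. -/
theorem parallelSum_mul_norm_sq_eq {a b : ℝ} (ha : 0 ≤ a) (hb : 0 ≤ b) (y : ℂ) :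
    a * ‖y - ((a / (a + b) : ℝ) : ℂ) * y‖ ^ 2 + b * ‖((a / (a + b) : ℝ) : ℂ) * y‖ ^ 2 =
      a * b / (a + b) * ‖y‖ ^ 2 := by
  rcases (add_nonneg ha hb).eq_or_lt with h | h
  · obtain rfl : a = 0 := by linarith
    obtain rfl : b = 0 := by linarith
    simp
  · have h1 : y - ((a / (a + b) : ℝ) : ℂ) * y = ((b / (a + b) : ℝ) : ℂ) * y := by
      have : ((b / (a + b) : ℝ) : ℂ) = 1 - ((a / (a + b) : ℝ) : ℂ) := by
        rw [← Complex.ofReal_one, ← Complex.ofReal_sub]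
        congr 1
        field_simp
        ring
      rw [this]; ring
    rw [h1, norm_mul, norm_mul, Complex.norm_real, Complex.norm_real, mul_pow, mul_pow,
      Real.norm_eq_abs, Real.norm_eq_abs, sq_abs, sq_abs]
    field_simp
    ring

/-! ### Traces in a pair of eigenbases, and Young's trace inequality -/

namespace Matrix

variable {n : Type*} [Fintype n] [DecidableEq n]

/-- The matrix of `C` relative to the eigenbases of `A` and `Z`. -/
noncomputable def eigenCoeff {A Z : Matrix n n ℂ} (hA : A.IsHermitian) (hZ : Z.IsHermitian)
    (C : Matrix n n ℂ) : Matrix n n ℂ :=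
  (hA.eigenvectorUnitary : Matrix n n ℂ)ᴴ * C * (hZ.eigenvectorUnitary : Matrix n n ℂ)

theorem trace_conjTranspose_mul_diagonal_mul_mul_diagonal (f g : n → ℝ) (C : Matrix n n ℂ) :
    (Cᴴ * diagonal (fun i => (f i : ℂ)) * C * diagonal (fun i => (g i : ℂ))).trace =
      ((∑ ij : n × n, f ij.1 * g ij.2 * ‖C ij.1 ij.2‖ ^ 2 : ℝ) : ℂ) := by
  rw [Fintype.sum_prod_type, Finset.sum_comm]
  simp only [trace, diag_apply, mul_diagonal]
  simp only [mul_apply (M := Cᴴ * _), mul_diagonal, conjTranspose_apply]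
  push_cast
  refine Finset.sum_congr rfl fun j _ => ?_
  rw [Finset.sum_mul]
  refine Finset.sum_congr rfl fun i _ => ?_
  rw [← Complex.mul_conj']
  simp only [Complex.star_def]
  ring

/-- `tr (C^* f(A) C g(Z))` in eigenbases of `A` and `Z`. -/
theorem trace_conjTranspose_mul_cfc_mul_mul_cfc {A Z : Matrix n n ℂ} (hA : A.IsHermitian)
    (hZ : Z.IsHermitian) (f g : ℝ → ℝ) (C : Matrix n n ℂ) :
    (Cᴴ * cfc f A * C * cfc g Z).trace =
      ((∑ ij : n × n, f (hA.eigenvalues ij.1) * g (hZ.eigenvalues ij.2) *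
        ‖eigenCoeff hA hZ C ij.1 ij.2‖ ^ 2 : ℝ) : ℂ) := by
  rw [← trace_conjTranspose_mul_diagonal_mul_mul_diagonal (fun i => f (hA.eigenvalues i))
    (fun i => g (hZ.eigenvalues i)) (eigenCoeff hA hZ C), hA.cfc_eq, hZ.cfc_eq,
    IsHermitian.cfc, IsHermitian.cfc, Unitary.conjStarAlgAut_apply, Unitary.conjStarAlgAut_apply,
    eigenCoeff]
  simp only [conjTranspose_mul, conjTranspose_conjTranspose, star_eq_conjTranspose]
  rw [← mul_assoc, ← mul_assoc, trace_mul_comm]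
  simp only [mul_assoc]
  rfl

theorem eigenCoeff_add {A Z : Matrix n n ℂ} (hA : A.IsHermitian) (hZ : Z.IsHermitian)
    (C D : Matrix n n ℂ) : eigenCoeff hA hZ (C + D) = eigenCoeff hA hZ C + eigenCoeff hA hZ D := by
  simp [eigenCoeff, mul_add, add_mul]

/-- Lets the optimal decomposition be prescribed entry by entry. -/
theorem exists_eigenCoeff_eq {A Z : Matrix n n ℂ} (hA : A.IsHermitian) (hZ : Z.IsHermitian)
    (D : Matrix n n ℂ) : ∃ C, eigenCoeff hA hZ C = D := by
  refine ⟨(hA.eigenvectorUnitary : Matrix n n ℂ) * D * (hZ.eigenvectorUnitary : Matrix n n ℂ)ᴴ, ?_⟩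
  have h1 : (hA.eigenvectorUnitary : Matrix n n ℂ)ᴴ * hA.eigenvectorUnitary = 1 :=
    Unitary.coe_star_mul_self hA.eigenvectorUnitary
  have h2 : (hZ.eigenvectorUnitary : Matrix n n ℂ)ᴴ * hZ.eigenvectorUnitary = 1 :=
    Unitary.coe_star_mul_self hZ.eigenvectorUnitary
  rw [eigenCoeff]
  simp only [mul_assoc, h2, mul_one]
  rw [← mul_assoc, h1, one_mul]

theorem trace_conjTranspose_mul_rpow_mul_mul_rpow {A Z : Matrix n n ℂ} (hA : A.PosSemidef)
    (hZ : Z.PosSemidef) (r s : ℝ) (C : Matrix n n ℂ) :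
    (Cᴴ * A ^ r * C * Z ^ s).trace =
      ((∑ ij : n × n, hA.1.eigenvalues ij.1 ^ r * hZ.1.eigenvalues ij.2 ^ s *
        ‖eigenCoeff hA.1 hZ.1 C ij.1 ij.2‖ ^ 2 : ℝ) : ℂ) := by
  rw [CFC.rpow_eq_cfc_real hA.nonneg, CFC.rpow_eq_cfc_real hZ.nonneg,
    trace_conjTranspose_mul_cfc_mul_mul_cfc hA.1 hZ.1]

/-- Z only fixes the second basis: its zeroth power is 1, even if Z is singular. -/
theorem trace_conjTranspose_mul_mul {A Z : Matrix n n ℂ} (hA : A.PosSemidef)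
    (hZ : Z.PosSemidef) (C : Matrix n n ℂ) :
    (Cᴴ * A * C).trace = ((∑ ij : n × n, hA.1.eigenvalues ij.1 *
        ‖eigenCoeff hA.1 hZ.1 C ij.1 ij.2‖ ^ 2 : ℝ) : ℂ) := by
  have := trace_conjTranspose_mul_rpow_mul_mul_rpow hA hZ 1 0 C
  rw [CFC.rpow_one A hA.nonneg, CFC.rpow_zero Z hZ.nonneg] at this
  simpa using this

theorem trace_conjTranspose_mul_self_mul {A Z : Matrix n n ℂ} (hA : A.PosSemidef)
    (hZ : Z.PosSemidef) (C : Matrix n n ℂ) :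
    (Cᴴ * C * Z).trace = ((∑ ij : n × n, hZ.1.eigenvalues ij.2 *
        ‖eigenCoeff hA.1 hZ.1 C ij.1 ij.2‖ ^ 2 : ℝ) : ℂ) := by
  have := trace_conjTranspose_mul_rpow_mul_mul_rpow hA hZ 0 1 C
  rw [CFC.rpow_one Z hZ.nonneg, CFC.rpow_zero A hA.nonneg] at this
  simpa using this

/-- Young's trace inequality `tr (X Z^(1-p)) ≤ p tr X^(1/p) + (1-p) tr Z`. -/
theorem PosSemidef.re_trace_mul_rpow_le {X Z : Matrix n n ℂ} (hX : X.PosSemidef)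
    (hZ : Z.PosSemidef) {p : ℝ} (hp0 : 0 < p) (hp1 : p < 1) :
    (X * Z ^ (1 - p)).trace.re ≤ p * (X ^ (1 / p)).trace.re + (1 - p) * Z.trace.re := by
  -- With C = 1 the weights are the squared overlaps of the two eigenbases, so all three traces
  -- become sums to which scalar Young applies termwise.
  have e1 := trace_conjTranspose_mul_rpow_mul_mul_rpow hX hZ 1 (1 - p) 1
  have e2 := trace_conjTranspose_mul_rpow_mul_mul_rpow hX hZ (1 / p) 0 1
  have e3 := trace_conjTranspose_mul_self_mul hX hZ 1
  rw [CFC.rpow_one X hX.nonneg] at e1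
  rw [CFC.rpow_zero Z hZ.nonneg] at e2
  simp only [conjTranspose_one, one_mul, mul_one] at e1 e2 e3
  rw [e1, e2, e3, Complex.ofReal_re, Complex.ofReal_re, Complex.ofReal_re, Finset.mul_sum,
    Finset.mul_sum, ← Finset.sum_add_distrib]
  refine Finset.sum_le_sum fun ij _ => ?_
  have hx := hX.eigenvalues_nonneg ij.1
  have hz := hZ.eigenvalues_nonneg ij.2
  have := Real.geom_mean_le_arith_mean2_weighted hp0.le (sub_pos.2 hp1).le
    (Real.rpow_nonneg hx (1 / p)) hz (by ring)
  rw [← Real.rpow_mul hx, one_div_mul_cancel hp0.ne'] at this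
  simp only [Real.rpow_zero, mul_one]
  nlinarith [sq_nonneg ‖eigenCoeff hX.1 hZ.1 1 ij.1 ij.2‖]

/-- The equality case of Young's trace inequality. -/
theorem PosSemidef.mul_rpow_rpow {X : Matrix n n ℂ} (hX : X.PosSemidef) {p : ℝ}
    (hp0 : 0 < p) : X * (X ^ (1 / p)) ^ (1 - p) = X ^ (1 / p) := by
  have hc : ∀ f : ℝ → ℝ, ContinuousOn f (spectrum ℝ X) := fun f =>
    (Matrix.finite_real_spectrum (A := X)).continuousOn f
  have hc' : ContinuousOn (fun x : ℝ => x ^ (1 - p))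
      (Set.image (fun x : ℝ => x ^ (1 / p)) (spectrum ℝ X)) :=
    ((Matrix.finite_real_spectrum (A := X)).image _).continuousOn _
  rw [CFC.rpow_eq_cfc_real (a := X ^ (1 / p)) CFC.rpow_nonneg, CFC.rpow_eq_cfc_real hX.nonneg,
    ← cfc_comp' _ _ X hc' (hc _) hX.1.isSelfAdjoint]
  conv_lhs => enter [1]; rw [← cfc_id' ℝ X hX.1.isSelfAdjoint]
  rw [← cfc_mul _ _ X (hc _) (hc _)]
  refine cfc_congr fun x hx => ?_
  have hx0 : 0 ≤ x := spectrum_nonneg_of_nonneg hX.nonneg hx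
  rcases hx0.eq_or_lt with rfl | hx0
  · simp [hp0.ne']
  · rw [← Real.rpow_mul hx0.le]
    nth_rewrite 1 [← Real.rpow_one x]
    rw [← Real.rpow_add hx0]
    congr 1
    field_simp
    ring

theorem PosSemidef.re_trace_mul_le {A X Y : Matrix n n ℂ} (hA : A.PosSemidef) (h : X ≤ Y) :
    (X * A).trace.re ≤ (Y * A).trace.re := by
  have h1 : (Y - X).PosSemidef := Matrix.le_iff.1 h
  obtain ⟨C, rfl⟩ := CStarAlgebra.nonneg_iff_eq_star_mul_self.1 hA.nonneg
  have h2 := (h1.mul_mul_conjTranspose_same C).trace_nonneg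
  rw [star_eq_conjTranspose, ← sub_nonneg, ← Complex.sub_re, ← trace_sub, ← sub_mul, ← mul_assoc,
    trace_mul_comm, ← mul_assoc]
  exact (Complex.le_def.1 h2).1

end Matrix

/-! ### Schwarz maps, their adjoints, and Lieb monotonicity -/

section Schwarz

variable {m n : ℕ} {Φ : Matrix (Fin m) (Fin m) ℂ →ₗ[ℂ] Matrix (Fin n) (Fin n) ℂ}

theorem IsSchwarzMap.posSemidef (hΦ : IsSchwarzMap Φ) (K : Matrix (Fin m) (Fin m) ℂ) :
    (Φ (Kᴴ * K)).PosSemidef :=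
  Matrix.nonneg_iff_posSemidef.1
    ((Matrix.posSemidef_conjTranspose_mul_self (Φ K)).nonneg.trans (hΦ K))

/-- Polarization: L + L^* is a combination of matrices K^*K, whose images are Hermitian. Taking L =
K and L = iK separates Φ(K^*) from Φ(K)^*. -/
theorem IsSchwarzMap.map_conjTranspose (hΦ : IsSchwarzMap Φ) (K : Matrix (Fin m) (Fin m) ℂ) :
    Φ Kᴴ = (Φ K)ᴴ := by
  have hS : ∀ L : Matrix (Fin m) (Fin m) ℂ, (Φ L + Φ Lᴴ)ᴴ = Φ L + Φ Lᴴ := by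
    intro L
    have e : Φ L + Φ Lᴴ = Φ ((L + 1)ᴴ * (L + 1)) - Φ (Lᴴ * L) - Φ ((1 : Matrix _ _ ℂ)ᴴ * 1) := by
      rw [← map_add, ← map_sub, ← map_sub]
      congr 1
      simp only [Matrix.conjTranspose_add, Matrix.conjTranspose_one, add_mul, mul_add, mul_one,
        one_mul]
      abel
    rw [e, Matrix.conjTranspose_sub, Matrix.conjTranspose_sub, (hΦ.posSemidef _).1,
      (hΦ.posSemidef _).1, (hΦ.posSemidef _).1]
  have h1 := hS K
  have h2 := hS (Complex.I • K)
  simp only [Matrix.conjTranspose_smul, map_smul, Matrix.conjTranspose_add, Complex.star_def,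
    Complex.conj_I, neg_smul, Matrix.conjTranspose_neg, map_neg] at h1 h2
  have h3 := congrArg (fun M => Complex.I • M) h2
  simp only [smul_add, smul_neg, smul_smul, Complex.I_mul_I, neg_neg, neg_smul,
    one_smul] at h3
  have h4 : (2 : ℂ) • Φ Kᴴ = (2 : ℂ) • (Φ K)ᴴ := by
    rw [two_smul, two_smul]
    calc Φ Kᴴ + Φ Kᴴ = (Φ K + Φ Kᴴ) + (-Φ K + Φ Kᴴ) := by abel
      _ = (Φ K)ᴴ + (Φ K)ᴴ := by rw [← h1, ← h3]; abel
  exact smul_right_injective _ two_ne_zero h4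

theorem trace_mul_hsAdjoint (hΦ : IsSchwarzMap Φ) (X : Matrix (Fin m) (Fin m) ℂ)
    (Y : Matrix (Fin n) (Fin n) ℂ) : (X * hsAdjoint Φ Y).trace = (Φ X * Y).trace := by
  have := trace_conjTranspose_mul_hsAdjoint Φ Xᴴ Y
  rwa [hΦ.map_conjTranspose, Matrix.conjTranspose_conjTranspose,
    Matrix.conjTranspose_conjTranspose] at this

/-- Duality: ⟨x, Φ†(A) x⟩ = tr Φ(xx^*) A, a trace of a product of two positive semidefinite
matrices. -/
theorem IsSchwarzMap.posSemidef_hsAdjoint (hΦ : IsSchwarzMap Φ) {A : Matrix (Fin n) (Fin n) ℂ}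
    (hA : A.PosSemidef) : (hsAdjoint Φ A).PosSemidef := by
  refine Matrix.PosSemidef.of_dotProduct_mulVec_nonneg ?_ fun x => ?_
  · ext i j
    simp only [Matrix.conjTranspose_apply, hsAdjoint, LinearMap.coe_mk, AddHom.coe_mk,
      Matrix.of_apply]
    rw [← Matrix.trace_conjTranspose, Matrix.conjTranspose_mul, Matrix.conjTranspose_conjTranspose,
      hA.1, Matrix.trace_mul_comm, ← hΦ.map_conjTranspose]
    simp
  · have e : star x ⬝ᵥ (hsAdjoint Φ A).mulVec x =
        (Matrix.vecMulVec x (star x) * hsAdjoint Φ A).trace := by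
      rw [Matrix.vecMulVec_mul, Matrix.trace_vecMulVec, Matrix.dotProduct_mulVec, dotProduct_comm]
    obtain ⟨K, hK⟩ := CStarAlgebra.nonneg_iff_eq_star_mul_self.1
      (Matrix.posSemidef_vecMulVec_self_star x).nonneg
    obtain ⟨C, rfl⟩ := CStarAlgebra.nonneg_iff_eq_star_mul_self.1 hA.nonneg
    rw [e, hK, trace_mul_hsAdjoint hΦ, Matrix.star_eq_conjTranspose, Matrix.star_eq_conjTranspose,
      ← mul_assoc, Matrix.trace_mul_comm, ← mul_assoc]
    exact ((hΦ.posSemidef K).mul_mul_conjTranspose_same C).trace_nonneg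

theorem IsUnitalMap.trace_hsAdjoint (hΦ1 : IsUnitalMap Φ) (Y : Matrix (Fin n) (Fin n) ℂ) :
    (hsAdjoint Φ Y).trace = Y.trace := by
  have := trace_conjTranspose_mul_hsAdjoint Φ 1 Y
  rw [hΦ1] at this
  simpa using this

theorem IsSchwarzMap.re_trace_self_mul_le (hΦ : IsSchwarzMap Φ) {Z : Matrix (Fin n) (Fin n) ℂ}
    (hZ : Z.PosSemidef) (W : Matrix (Fin m) (Fin m) ℂ) :
    ((Φ W)ᴴ * Φ W * Z).trace.re ≤ (Wᴴ * W * hsAdjoint Φ Z).trace.re := by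
  rw [trace_mul_hsAdjoint hΦ]
  exact hZ.re_trace_mul_le (hΦ W)

/-- The Schwarz inequality at U^* reads Φ(U) Φ(U)^* ≤ Φ(UU^*), which handles the term with A on the
left. -/
theorem IsSchwarzMap.re_trace_mul_mul_le (hΦ : IsSchwarzMap Φ) {A : Matrix (Fin n) (Fin n) ℂ}
    (hA : A.PosSemidef) (U : Matrix (Fin m) (Fin m) ℂ) :
    ((Φ U)ᴴ * A * Φ U).trace.re ≤ (Uᴴ * hsAdjoint Φ A * U).trace.re := by
  have := hΦ.re_trace_self_mul_le hA Uᴴ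
  rw [hΦ.map_conjTranspose, Matrix.conjTranspose_conjTranspose,
    Matrix.conjTranspose_conjTranspose] at this
  rwa [Matrix.trace_mul_comm, ← mul_assoc, Matrix.trace_mul_comm (Uᴴ * _), ← mul_assoc]

/-- Monotonicity of Lieb's functional `tr (B^* A^p B Z^(1-p))` under Schwarz maps. -/
theorem IsSchwarzMap.re_trace_rpow_mul_rpow_le (hΦ : IsSchwarzMap Φ) {p : ℝ} (hp0 : 0 < p)
    (hp1 : p < 1) {A Z : Matrix (Fin n) (Fin n) ℂ} (hA : A.PosSemidef) (hZ : Z.PosSemidef)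
    (B : Matrix (Fin m) (Fin m) ℂ) :
    ((Φ B)ᴴ * A ^ p * Φ B * Z ^ (1 - p)).trace.re ≤
      (Bᴴ * (hsAdjoint Φ A) ^ p * B * (hsAdjoint Φ Z) ^ (1 - p)).trace.re := by
  have hA' := hΦ.posSemidef_hsAdjoint hA
  have hZ' := hΦ.posSemidef_hsAdjoint hZ
  rw [Matrix.trace_conjTranspose_mul_rpow_mul_mul_rpow hA hZ,
    Matrix.trace_conjTranspose_mul_rpow_mul_mul_rpow hA' hZ', Complex.ofReal_re, Complex.ofReal_re]
  refine sum_rpow_mul_rpow_le_of_parallelSum_le ⟨hp0, hp1⟩ (fun _ => hA.eigenvalues_nonneg _)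
    (fun _ => hZ.eigenvalues_nonneg _) (fun _ => hA'.eigenvalues_nonneg _)
    (fun _ => hZ'.eigenvalues_nonneg _) fun t ht => ?_
  -- The entrywise minimizer of a|y - w|² + tz|w|² is w = a y / (a + tz); a zero denominator forces
  -- a = tz = 0 and gives w = 0.
  obtain ⟨W, hW⟩ := Matrix.exists_eigenCoeff_eq hA'.1 hZ'.1 (Matrix.of fun i j =>
    ((hA'.1.eigenvalues i / (hA'.1.eigenvalues i + t * hZ'.1.eigenvalues j) : ℝ) : ℂ) *
      Matrix.eigenCoeff hA'.1 hZ'.1 B i j)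
  obtain ⟨U, rfl⟩ : ∃ U, U + W = B := ⟨B - W, sub_add_cancel _ _⟩
  have hU : ∀ i j, Matrix.eigenCoeff hA'.1 hZ'.1 U i j =
      Matrix.eigenCoeff hA'.1 hZ'.1 (U + W) i j - Matrix.eigenCoeff hA'.1 hZ'.1 W i j := by
    intro i j
    rw [Matrix.eigenCoeff_add, Matrix.add_apply, add_sub_cancel_right]
  calc _ ≤ ((Φ U)ᴴ * A * Φ U).trace.re + t * ((Φ W)ᴴ * Φ W * Z).trace.re := by
        rw [Matrix.trace_conjTranspose_mul_mul hA hZ, Matrix.trace_conjTranspose_mul_self_mul hA hZ,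
          Complex.ofReal_re, Complex.ofReal_re, Finset.mul_sum, ← Finset.sum_add_distrib]
        refine Finset.sum_le_sum fun ij _ => ?_
        rw [map_add, Matrix.eigenCoeff_add, Matrix.add_apply, ← mul_assoc t]
        exact parallelSum_mul_norm_add_sq_le (hA.eigenvalues_nonneg _)
          (mul_nonneg ht.le (hZ.eigenvalues_nonneg _)) _ _
    _ ≤ (Uᴴ * hsAdjoint Φ A * U).trace.re + t * (Wᴴ * W * hsAdjoint Φ Z).trace.re :=
        add_le_add (hΦ.re_trace_mul_mul_le hA U)
          (mul_le_mul_of_nonneg_left (hΦ.re_trace_self_mul_le hZ W) ht.le)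
    _ = _ := by
        rw [Matrix.trace_conjTranspose_mul_mul hA' hZ',
          Matrix.trace_conjTranspose_mul_self_mul hA' hZ',
          Complex.ofReal_re, Complex.ofReal_re, Finset.mul_sum, ← Finset.sum_add_distrib]
        refine Finset.sum_congr rfl fun ij _ => ?_
        rw [hU, hW, Matrix.of_apply, ← mul_assoc t]
        exact parallelSum_mul_norm_sq_eq (hA'.eigenvalues_nonneg _)
          (mul_nonneg ht.le (hZ'.eigenvalues_nonneg _)) _

end Schwarz

/-- Real powers are those of the continuous functional calculus for positive semidefinite matrices.
The inequality is in the order of `ℂ`: the traces have equal imaginary parts (both are real) and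
their real parts satisfy the inequality. -/
theorem theorem1p6 (m n : ℕ) (p : ℝ) (hp0 : 0 < p) (hp1 : p ≤ 1)
    (Φ : Matrix (Fin m) (Fin m) ℂ →ₗ[ℂ] Matrix (Fin n) (Fin n) ℂ)
    (hΦ : IsSchwarzMap Φ) (hΦ1 : IsUnitalMap Φ)
    (A : Matrix (Fin n) (Fin n) ℂ) (hA : A.PosDef)
    (B : Matrix (Fin m) (Fin m) ℂ) :
    (((Φ B)ᴴ * A ^ p * Φ B) ^ (1 / p)).trace ≤ ((Bᴴ * (hsAdjoint Φ A) ^ p * B) ^ (1 / p)).trace := by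
  have hA0 := hA.posSemidef
  have hA' := hΦ.posSemidef_hsAdjoint hA0
  have hX : ((Φ B)ᴴ * A ^ p * Φ B).PosSemidef :=
    Matrix.PosSemidef.conjTranspose_mul_mul_same
      (Matrix.nonneg_iff_posSemidef.1 (CFC.rpow_nonneg (a := A) (y := p))) _
  have hX' : (Bᴴ * (hsAdjoint Φ A) ^ p * B).PosSemidef :=
    Matrix.PosSemidef.conjTranspose_mul_mul_same
      (Matrix.nonneg_iff_posSemidef.1 (CFC.rpow_nonneg (a := hsAdjoint Φ A) (y := p))) _
  have h1 := Matrix.nonneg_iff_posSemidef.1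
    (CFC.rpow_nonneg (a := (Φ B)ᴴ * A ^ p * Φ B) (y := 1 / p))
  have h2 := Matrix.nonneg_iff_posSemidef.1
    (CFC.rpow_nonneg (a := Bᴴ * (hsAdjoint Φ A) ^ p * B) (y := 1 / p))
  refine Complex.le_def.2 ⟨?_, (Complex.le_def.1 h1.trace_nonneg).2.symm.trans
    (Complex.le_def.1 h2.trace_nonneg).2⟩
  -- The interpolation needs p < 1; at p = 1 the claim is the Schwarz inequality itself, paired with
  -- A.
  rcases hp1.eq_or_lt with rfl | hp1
  · rw [div_one, CFC.rpow_one _ hX.nonneg, CFC.rpow_one _ hX'.nonneg, CFC.rpow_one _ hA0.nonneg,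
      CFC.rpow_one _ hA'.nonneg]
    exact hΦ.re_trace_mul_mul_le hA0 B
  -- Z = X^(1/p) is the equality case of Young for X, so the left side of `hLieb` collapses to tr
  -- X^(1/p).
  · have hLieb := hΦ.re_trace_rpow_mul_rpow_le hp0 hp1 hA0 h1 B
    have hYoung := hX'.re_trace_mul_rpow_le (hΦ.posSemidef_hsAdjoint h1) hp0 hp1
    rw [hX.mul_rpow_rpow hp0] at hLieb
    rw [hΦ1.trace_hsAdjoint] at hYoung
    refine le_of_mul_le_mul_left ?_ hp0
    linarith
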